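/- Let $\mathbb{E}$ be a finite-dimensional real vector space with a Euclidean norm $\|x\|=\langle Bx,x\rangle^{1/2}$, where $B:\mathbb E\to\mathbb E^*$ is self-adjoint and positive definite, and let $\|s\|_*=\langle s,B^{-1}s\rangle^{1/2}$ be the dual norm on $\mathbb{E}^*$; norms of multilinear forms are the induced ones. Let $\nu\in(0,1]$ and let $f:\mathbb{E}\to\mathbb{R}$ be convex and three times differentiable with $$\|D^3f(u)-D^3f(v)\|\le H_{f,3}(\nu)\,\|u-v\|^{\nu}\qquad\text{for all }u,v\in\mathbb{E}.$$ Fix $x\in\mathbb{E}$ and $H>0$, and set $$\Omega(y)=f(x)+\sum_{i=1}^{3}\frac{1}{i!}D^if(x)[y-x]^i+\frac{H}{6}\|y-x\|^{3+\nu},\qquad \rho(y)=\frac12\langle\nabla^2f(x)(y-x),y-x\rangle+\frac{1}{3+\nu}\|y-x\|^{3+\nu},$$ $$\beta(u,v)=\rho(v)-\rho(u)-\langle\nabla\rho(u),v-u\rangle.$$ Algorithm 1 starts from $y_0=x$ and some $L_0>0$. At iteration $k\ge 0$ it computes, for $i=0,1,2,\dots$, $$y_{k,i}^{+}\in\arg\min_{z\in\mathbb{E}}\left\{\langle\nabla\Omega(y_k),z-y_k\rangle+2^iL_k\,\beta(y_k,z)\right\}$$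 and lets $i_k$ be the first $i$ with $$\Omega(y_{k,i}^+)\le\Omega(y_k)+\langle\nabla\Omega(y_k),y_{k,i}^+-y_k\rangle+2^iL_k\,\beta(y_k,y_{k,i}^+);$$ then it sets $y_{k+1}=y_{k,i_k}^{+}$ and $L_{k+1}=2^{i_k-1}L_k$. Define (the first three when $H_{f,3}(\nu)>0$) $$\tau_H=\left[\frac{(3+\nu)H}{6H_{f,3}(\nu)}\right]^{\frac1{1+\nu}},\quad L_H=\max\left\{\frac{\tau_H+1}{\tau_H},\ \tau_H^{\nu}(\tau_H+1)H_{f,3}(\nu)\right\},\quad M_H=\max\{2L_0,4L_H\},$$ $$D_{x,H}=\max\left\{1,\ \left[\frac{6\|\nabla f(x)\|_*}{H}\right]^{\frac12},\ \frac{3\|\nabla^2f(x)\|}{H},\ \left[3+\frac{\|D^3f(x)\|}{H}\right]^{\frac1\nu}\right\},\quad \hat N_{x,H}=\|\nabla^2f(x)\|+(2+\nu)D_{x,H}^2,$$ $$F_x=D_{x,H}\left[\|\nabla f(x)\|_*+\tfrac12\|\nabla^2f(x)\|D_{x,H}+\|D^3f(x)\|D_{x,H}^2\right].$$ **Theorem.**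 Let $\epsilon\in(0,1)$, let $\{y_k\}_{k\ge0}$ be a sequence generated by Algorithm 1, and let $T\ge 0$ be an integer such that $\|\nabla\Omega(y_k)\|_*>\epsilon$ for $k=0,\dots,T$. Then: (a) if $H<\frac{6}{3+\nu}H_{f,3}(\nu)$, then $$T\le\left[\frac{\hat N_{x,H}^{3+\nu}(3+\nu)M_H^{2+\nu}F_x}{2^{-(1+\nu)}}\right]\epsilon^{-(3+\nu)};$$ (b) if $H=\frac{6}{3+\nu}H_{f,3}(\nu)$, then $$T\le 3\left[M_H\hat N_{x,H}\right]^{\frac{3+\nu}2}\left[\frac{(3+\nu)\hat N_{x,H}^2}{2^{-(2+\nu)}}\right]^{\frac12}\epsilon^{-\frac{3+\nu}2}.$$ -/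

import Mathlib

noncomputable section

namespace TensorModel

/- Throughout, `E` is a finite-dimensional real inner product space: its inner product is
`⟪u, v⟫ = ⟨B u, v⟩` for the self-adjoint positive definite operator `B : E → E*`, and the conjugate
norm of a functional is its operator norm as an element of `E →L[ℝ] ℝ`. -/

variable {E : Type*} [NormedAddCommGroup E] [InnerProductSpace ℝ E]

/-- `f` is `p` times differentiable and its `p`-th derivative is `ν`-Hölder continuous on the whole
space with constant `Hf`. -/
def HolderDeriv (f : E → ℝ) (p : ℕ) (ν Hf : ℝ) : Prop :=
  (∀ m < p, Differentiable ℝ (iteratedFDeriv ℝ m f)) ∧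
    ∀ x y : E, ‖iteratedFDeriv ℝ p f x - iteratedFDeriv ℝ p f y‖ ≤ Hf * ‖x - y‖ ^ ν

/-- The Taylor polynomial `Φ_{x,p}` of order `p` of `f` at `x`. -/
def taylorModel (f : E → ℝ) (p : ℕ) (x y : E) : ℝ :=
  f x + ∑ i ∈ Finset.Icc 1 p, 1 / (Nat.factorial i : ℝ) * iteratedFDeriv ℝ i f x (fun _ => y - x)

/-- The regularized tensor model
`Ω_{x,p,H}^{(ν)}(y) = Φ_{x,p}(y) + (H / p!) ‖y - x‖ ^ (p + ν)`. -/
def regModel (f : E → ℝ) (p : ℕ) (ν H : ℝ) (x y : E) : ℝ :=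
  taylorModel f p x y + H / (Nat.factorial p : ℝ) * ‖y - x‖ ^ ((p : ℝ) + ν)

/-- The scaling function
`ρ_x(y) = (1/2) ⟨∇²f(x)(y - x), y - x⟩ + (1/(3+ν)) ‖y - x‖ ^ (3 + ν)`. -/
def scaling (f : E → ℝ) (ν : ℝ) (x y : E) : ℝ :=
  1 / 2 * iteratedFDeriv ℝ 2 f x (fun _ => y - x) + 1 / (3 + ν) * ‖y - x‖ ^ (3 + ν)

/-- The Bregman distance `β_d(u, v) = d(v) - d(u) - ⟨∇d(u), v - u⟩`. -/
def bregman (d : E → ℝ) (u v : E) : ℝ :=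
  d v - d u - fderiv ℝ d u (v - u)

/-- `y` is a sequence generated by the adaptive Bregman proximal gradient method for `min g` with
scaling function `d`, started at `y₀` with initial estimate `L₀ > 0`. Here `L k` are the successive
estimates, `i k` is the index at which the `k`-th line search stops, and `z k j` (`j ≤ i k`) are the
trial points computed during the `k`-th line search. -/
def IsBregmanGradientRun (g d : E → ℝ) (y₀ : E) (L₀ : ℝ) (y : ℕ → E) : Prop :=
  0 < L₀ ∧ y 0 = y₀ ∧
    ∃ (L : ℕ → ℝ) (i : ℕ → ℕ) (z : ℕ → ℕ → E),
      L 0 = L₀ ∧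
      ∀ k,
        (∀ j ≤ i k, IsMinOn
          (fun w => fderiv ℝ g (y k) (w - y k) + 2 ^ j * L k * bregman d (y k) w)
          Set.univ (z k j)) ∧
        (∀ j < i k, ¬ g (z k j) ≤
          g (y k) + fderiv ℝ g (y k) (z k j - y k) + 2 ^ j * L k * bregman d (y k) (z k j)) ∧
        g (z k (i k)) ≤
          g (y k) + fderiv ℝ g (y k) (z k (i k) - y k)
            + 2 ^ (i k) * L k * bregman d (y k) (z k (i k)) ∧
        y (k + 1) = z k (i k) ∧
        L (k + 1) = (2 : ℝ) ^ ((i k : ℤ) - 1) * L k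

/-- `y` is a sequence generated by the adaptive Bregman gradient method applied to the third-order
model `Ω_{x,3,H}^{(ν)}` with scaling function `ρ_x`, started at `y₀ = x`. -/
def IsModelRun (f : E → ℝ) (ν H : ℝ) (x : E) (L₀ : ℝ) (y : ℕ → E) : Prop :=
  IsBregmanGradientRun (regModel f 3 ν H x) (scaling f ν x) x L₀ y

/-- `τ_H = [(3 + ν) H / (6 H_{f,3}(ν))] ^ (1 / (1 + ν))`. -/
def tauH (ν Hf H : ℝ) : ℝ :=
  ((3 + ν) * H / (6 * Hf)) ^ (1 / (1 + ν))

/-- `L_H = max {(τ_H + 1) / τ_H, τ_H ^ ν (τ_H + 1) H_{f,3}(ν)}`. -/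
def smoothConst (ν Hf H : ℝ) : ℝ :=
  max ((tauH ν Hf H + 1) / tauH ν Hf H) (tauH ν Hf H ^ ν * (tauH ν Hf H + 1) * Hf)

/-- `M_H = max {2 L₀, 4 L_H}`. -/
def constM (ν Hf H L₀ : ℝ) : ℝ :=
  max (2 * L₀) (4 * smoothConst ν Hf H)

/-- `D_{x,H}`, the maximum of `1`, `[6 ‖∇f(x)‖_* / H] ^ (1/2)`, `3 ‖∇²f(x)‖ / H` and
`[3 + ‖D³f(x)‖ / H] ^ (1/ν)`. -/
def constD (f : E → ℝ) (ν H : ℝ) (x : E) : ℝ :=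
  max (max 1 ((6 * ‖fderiv ℝ f x‖ / H) ^ (1 / 2 : ℝ)))
    (max (3 * ‖iteratedFDeriv ℝ 2 f x‖ / H)
      ((3 + ‖iteratedFDeriv ℝ 3 f x‖ / H) ^ (1 / ν)))

/-- `N̂_{x,H} = ‖∇²f(x)‖ + (2 + ν) D_{x,H}²`. -/
def constN (f : E → ℝ) (ν H : ℝ) (x : E) : ℝ :=
  ‖iteratedFDeriv ℝ 2 f x‖ + (2 + ν) * constD f ν H x ^ 2

/-- `F_x = D_{x,H} [‖∇f(x)‖_* + (1/2) ‖∇²f(x)‖ D_{x,H} + ‖D³f(x)‖ D_{x,H}²]`. -/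
def constF (f : E → ℝ) (ν H : ℝ) (x : E) : ℝ :=
  constD f ν H x *
    (‖fderiv ℝ f x‖ + 1 / 2 * ‖iteratedFDeriv ℝ 2 f x‖ * constD f ν H x
      + ‖iteratedFDeriv ℝ 3 f x‖ * constD f ν H x ^ 2)

end TensorModel

end

/-! Convexity of `f` controls its third derivative: the Hessian at a shifted point is still positive
semidefinite, so the Hölder condition gives |D³f(x)[h,k,k]| ≤ (1/τ) D²f(x)[k,k] + τ^ν Hf ‖h‖^(1+ν)
‖k‖² for every τ > 0 (`HolderDeriv.abs_third_le`). The right-hand side is matched by the two terms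
of ρ. With τ = τ_H, the model Ω is therefore L_H-smooth relative to ρ
(`HolderDeriv.bregman_regModel_le`), and the line search keeps its accepted constants bounded. With
τ = 1 at the critical H, Ω is convex (`HolderDeriv.bregman_regModel_nonneg`).

The scaling function ρ is uniformly convex of degree 3+ν, and its gradient is Lipschitz on the ball
of radius D that contains the iterates (`norm_sub_le_constD`). A gradient larger than ε forces a
step of length at least a multiple of ε, so each step lowers Ω by some δ of order ε^(3+ν)
(`bregman_step_decrease`). Dividing the total available decrease by δ gives (a).

For (b), convexity adds the O(1/K) bound on Ω(y_K) - Ω(y_{T+1}) (`mul_gap_le_of_potential`). The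
first half of the run makes this gap small, while the second half must lower Ω by δ per step;
combining them bounds T² by a multiple of 1/δ. -/

namespace TensorModel

variable {E : Type*} [NormedAddCommGroup E]

/-! ### Gradient monotonicity integrated along segments. -/

/-- The derivative of a differentiable function along the segment `t ↦ u + t • h`. -/
theorem hasDerivAt_comp_line [NormedSpace ℝ E] {F : Type*} [NormedAddCommGroup F] [NormedSpace ℝ F]
    {g : E → F} (hg : Differentiable ℝ g) (u h : E) (t : ℝ) :
    HasDerivAt (fun s : ℝ => g (u + s • h)) (fderiv ℝ g (u + t • h) h) t := by
  have h1 : HasDerivAt (fun s : ℝ => u + s • h) h t := by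
    simpa using ((hasDerivAt_id t).smul_const h).const_add u
  exact (hg (u + t • h)).hasFDerivAt.comp_hasDerivAt t h1

/-- A uniform monotonicity estimate for the gradient integrates to a lower bound on the Bregman
distance. -/
theorem le_bregman_of_gradient_monotone [InnerProductSpace ℝ E] {g : E → ℝ}
    (hg : Differentiable ℝ g) {c q : ℝ} (hq : 1 ≤ q)
    (hmono : ∀ u v : E, c * ‖v - u‖ ^ q ≤ (fderiv ℝ g v - fderiv ℝ g u) (v - u)) (u v : E) :
    c / q * ‖v - u‖ ^ q ≤ bregman g u v := by
  set h := v - u with hh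
  set φ : ℝ → ℝ := fun t => g (u + t • h) - t * fderiv ℝ g u h - t ^ q * (c / q * ‖h‖ ^ q) with hφ
  have hφ' : ∀ t : ℝ, HasDerivAt φ
      (fderiv ℝ g (u + t • h) h - 1 * fderiv ℝ g u h - q * t ^ (q - 1) * (c / q * ‖h‖ ^ q)) t :=
    fun t => ((hasDerivAt_comp_line hg u h t).sub ((hasDerivAt_id t).mul_const _)).sub
      ((Real.hasDerivAt_rpow_const (Or.inr hq)).mul_const _)
  have hmon : MonotoneOn φ (Set.Icc 0 1) := by
    refine monotoneOn_of_deriv_nonneg (convex_Icc 0 1)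
      (fun t _ => (hφ' t).continuousAt.continuousWithinAt)
      (fun t _ => (hφ' t).differentiableAt.differentiableWithinAt) fun t ht => ?_
    rw [interior_Icc] at ht
    rw [(hφ' t).deriv]
    -- Monotonicity between `u` and `u + t • h` carries a factor `t` on both sides; cancelling it
    -- leaves the sign of φ'(t).
    have h1 := hmono u (u + t • h)
    simp only [add_sub_cancel_left, norm_smul, Real.norm_eq_abs, abs_of_pos ht.1, map_smul,
      smul_eq_mul, sub_apply] at h1
    rw [Real.mul_rpow ht.1.le (norm_nonneg _)] at h1
    have h2 : t ^ q = t * t ^ (q - 1) := by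
      rw [← Real.rpow_one_add' ht.1.le (by linarith)]; congr 1; ring
    rw [h2] at h1
    have h3 : t * (c * (t ^ (q - 1) * ‖h‖ ^ q)) ≤
        t * (fderiv ℝ g (u + t • h) h - fderiv ℝ g u h) := by linarith
    have h4 := le_of_mul_le_mul_left h3 ht.1
    have h5 : q * t ^ (q - 1) * (c / q * ‖h‖ ^ q) = c * (t ^ (q - 1) * ‖h‖ ^ q) := by
      field_simp
    linarith
  have := hmon (Set.left_mem_Icc.2 zero_le_one) (Set.right_mem_Icc.2 zero_le_one) zero_le_one
  simp only [hφ, zero_smul, add_zero, zero_mul, one_smul, one_mul, Real.one_rpow,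
    Real.zero_rpow (by linarith : q ≠ 0), sub_zero, hh, add_sub_cancel] at this
  simp only [bregman]
  linarith

/-- The Bregman distance of a function with monotone gradient is nonnegative. -/
theorem bregman_nonneg_of_gradient_monotone [InnerProductSpace ℝ E] {g : E → ℝ}
    (hg : Differentiable ℝ g)
    (hmono : ∀ u v : E, 0 ≤ (fderiv ℝ g v - fderiv ℝ g u) (v - u)) (u v : E) :
    0 ≤ bregman g u v := by
  have := le_bregman_of_gradient_monotone (c := 0) hg le_rfl (by simpa using hmono) u v
  simpa using this

/-! ### Monotonicity and Lipschitz estimates for the gradient of a power of the norm. -/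

section NormPow

variable [InnerProductSpace ℝ E]

/-- The two sides differ by ½(‖a‖^s - ‖b‖^s)(‖a‖² - ‖b‖²), which is nonnegative because t ↦ t^s is
monotone. -/
theorem half_rpow_add_rpow_mul_le_inner {s : ℝ} (hs : 0 ≤ s) (a b : E) :
    1 / 2 * (‖a‖ ^ s + ‖b‖ ^ s) * ‖a - b‖ ^ 2 ≤ inner ℝ (‖a‖ ^ s • a - ‖b‖ ^ s • b) (a - b) := by
  have h1 : 0 ≤ (‖a‖ ^ s - ‖b‖ ^ s) * (‖a‖ - ‖b‖) := by
    rcases le_total ‖a‖ ‖b‖ with h | h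
    · exact mul_nonneg_of_nonpos_of_nonpos
        (sub_nonpos.2 (Real.rpow_le_rpow (norm_nonneg _) h hs)) (sub_nonpos.2 h)
    · exact mul_nonneg
        (sub_nonneg.2 (Real.rpow_le_rpow (norm_nonneg _) h hs)) (sub_nonneg.2 h)
  have h2 : 0 ≤ (‖a‖ ^ s - ‖b‖ ^ s) * (‖a‖ - ‖b‖) * (‖a‖ + ‖b‖) :=
    mul_nonneg h1 (add_nonneg (norm_nonneg _) (norm_nonneg _))
  rw [@norm_sub_sq_real]
  simp only [inner_sub_left, inner_sub_right, inner_smul_left, real_inner_self_eq_norm_sq,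
    real_inner_comm a b, conj_trivial]
  nlinarith

theorem midpoint_rpow_le {s : ℝ} (hs : 1 ≤ s) {α β : ℝ} (hα : 0 ≤ α) (hβ : 0 ≤ β) :
    ((α + β) / 2) ^ s ≤ 1 / 2 * (α ^ s + β ^ s) := by
  have := (convexOn_rpow hs).2 (Set.mem_Ici.2 hα) (Set.mem_Ici.2 hβ)
    (by norm_num : (0 : ℝ) ≤ 1 / 2) (by norm_num : (0 : ℝ) ≤ 1 / 2) (by norm_num)
  rw [show (α + β) / 2 = 1 / 2 * α + 1 / 2 * β by ring, mul_add]
  exact this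

/-- The midpoint is the direction in which the third derivative enters `fderiv_regModel_sub`; this
lets the regularizer absorb that term. -/
theorem norm_midpoint_rpow_mul_le_inner {s : ℝ} (hs : 1 ≤ s) (a b : E) :
    ‖(1 / 2 : ℝ) • (a + b)‖ ^ s * ‖a - b‖ ^ 2 ≤
      inner ℝ (‖a‖ ^ s • a - ‖b‖ ^ s • b) (a - b) := by
  refine le_trans (mul_le_mul_of_nonneg_right ?_ (sq_nonneg _))
    (half_rpow_add_rpow_mul_le_inner (by linarith) a b)
  refine le_trans (Real.rpow_le_rpow (norm_nonneg _) ?_ (by linarith))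
    (midpoint_rpow_le hs (norm_nonneg a) (norm_nonneg b))
  rw [norm_smul, Real.norm_of_nonneg (by norm_num)]
  linarith [norm_add_le a b]

/-- Uniform monotonicity of the gradient of `‖·‖ ^ (s + 2) / (s + 2)`. -/
theorem two_rpow_mul_norm_rpow_le_inner {s : ℝ} (hs : 1 ≤ s) (a b : E) :
    (2 : ℝ) ^ (-s) * ‖a - b‖ ^ (s + 2) ≤ inner ℝ (‖a‖ ^ s • a - ‖b‖ ^ s • b) (a - b) := by
  refine le_trans ?_ (half_rpow_add_rpow_mul_le_inner (by linarith) a b)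
  have h1 : (‖a - b‖ / 2) ^ s ≤ 1 / 2 * (‖a‖ ^ s + ‖b‖ ^ s) :=
    le_trans (Real.rpow_le_rpow (by positivity) (by linarith [norm_sub_le a b]) (by linarith))
      (midpoint_rpow_le hs (norm_nonneg a) (norm_nonneg b))
  have h2 : (2 : ℝ) ^ (-s) * ‖a - b‖ ^ (s + 2) = (‖a - b‖ / 2) ^ s * ‖a - b‖ ^ 2 := by
    rw [Real.div_rpow (norm_nonneg _) (by norm_num), Real.rpow_neg (by norm_num),
      Real.rpow_add' (norm_nonneg _) (by linarith), Real.rpow_two]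
    ring
  rw [h2]
  exact mul_le_mul_of_nonneg_right h1 (sq_nonneg _)

theorem abs_rpow_sub_rpow_le {s D α β : ℝ} (hs : 1 ≤ s) (hα : 0 ≤ α) (hβ : 0 ≤ β) (hαD : α ≤ D)
    (hβD : β ≤ D) : |α ^ s - β ^ s| ≤ s * D ^ (s - 1) * |α - β| := by
  have := (convex_Icc 0 D).norm_image_sub_le_of_norm_deriv_le (f := fun t : ℝ => t ^ s)
    (C := s * D ^ (s - 1)) (fun t _ => (Real.hasDerivAt_rpow_const (Or.inr hs)).differentiableAt)
    (fun t ht => ?_) ⟨hβ, hβD⟩ ⟨hα, hαD⟩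
  · simpa using this
  · rw [(Real.hasDerivAt_rpow_const (Or.inr hs)).deriv, Real.norm_of_nonneg
      (mul_nonneg (by linarith) (Real.rpow_nonneg ht.1 _))]
    exact mul_le_mul_of_nonneg_left (Real.rpow_le_rpow ht.1 ht.2 (by linarith)) (by linarith)

/-- The gradient of `‖·‖ ^ (s + 2) / (s + 2)` is Lipschitz on balls. -/
theorem norm_rpow_smul_sub_le {s D : ℝ} (hs : 1 ≤ s) {a b : E} (ha : ‖a‖ ≤ D) (hb : ‖b‖ ≤ D) :
    ‖‖a‖ ^ s • a - ‖b‖ ^ s • b‖ ≤ (1 + s) * D ^ s * ‖a - b‖ := by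
  have hD : 0 ≤ D := (norm_nonneg a).trans ha
  have h1 : ‖a‖ ^ s • a - ‖b‖ ^ s • b = ‖a‖ ^ s • (a - b) + (‖a‖ ^ s - ‖b‖ ^ s) • b := by
    module
  rw [h1]
  refine (norm_add_le _ _).trans ?_
  rw [norm_smul, norm_smul, Real.norm_of_nonneg (Real.rpow_nonneg (norm_nonneg _) _),
    Real.norm_eq_abs]
  have h2 : ‖a‖ ^ s ≤ D ^ s := Real.rpow_le_rpow (norm_nonneg _) ha (by linarith)
  have h3 := abs_rpow_sub_rpow_le hs (norm_nonneg a) (norm_nonneg b) ha hb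
  have h4 : |‖a‖ - ‖b‖| ≤ ‖a - b‖ := abs_norm_sub_norm_le a b
  have h5 : D ^ s = D ^ (s - 1) * D := by
    rw [← Real.rpow_add_one' hD (by linarith)]; congr 1; ring
  have h6 : 0 ≤ s * D ^ (s - 1) := mul_nonneg (by linarith) (Real.rpow_nonneg hD _)
  calc ‖a‖ ^ s * ‖a - b‖ + |‖a‖ ^ s - ‖b‖ ^ s| * ‖b‖
      ≤ D ^ s * ‖a - b‖ + s * D ^ (s - 1) * ‖a - b‖ * D := by
        gcongr
        exact h3.trans (mul_le_mul_of_nonneg_left h4 h6)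
    _ = (1 + s) * D ^ s * ‖a - b‖ := by rw [h5]; ring

end NormPow

/-! ### Symmetry of derivatives and the convexity bound on the third derivative. -/

section ThirdOrder

variable {E : Type*} [NormedAddCommGroup E] [NormedSpace ℝ E]

theorem iteratedFDeriv_three_apply (f : E → ℝ) (x : E) (m : Fin 3 → E) :
    iteratedFDeriv ℝ 3 f x m = fderiv ℝ (fderiv ℝ (fderiv ℝ f)) x (m 0) (m 1) (m 2) := by
  rw [iteratedFDeriv_succ_apply_right, iteratedFDeriv_two_apply]
  rfl

theorem fderiv_fderiv_symm {F : Type*} [NormedAddCommGroup F] [NormedSpace ℝ F] {f : E → F}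
    (hf : ContDiff ℝ 2 f) (x u v : E) :
    fderiv ℝ (fderiv ℝ f) x u v = fderiv ℝ (fderiv ℝ f) x v u :=
  (hf.contDiffAt.isSymmSndFDerivAt (by simp)).eq u v

theorem fderiv_fderiv_fderiv_symm {f : E → ℝ} (hf : ContDiff ℝ 3 f) (x u v w : E) :
    fderiv ℝ (fderiv ℝ (fderiv ℝ f)) x u v w = fderiv ℝ (fderiv ℝ (fderiv ℝ f)) x v u w := by
  rw [fderiv_fderiv_symm (hf.fderiv_right (by norm_num))]

theorem differentiable_fderiv_fderiv {f : E → ℝ} (hf : ContDiff ℝ 3 f) :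
    Differentiable ℝ (fderiv ℝ (fderiv ℝ f)) :=
  ((hf.fderiv_right (m := 2) (by norm_num)).fderiv_right (m := 1) (by norm_num)).differentiable
    (by norm_num)

/-- Differentiate the symmetry of the Hessian in the direction `u`. -/
theorem fderiv_fderiv_fderiv_symm' {f : E → ℝ} (hf : ContDiff ℝ 3 f) (x u v w : E) :
    fderiv ℝ (fderiv ℝ (fderiv ℝ f)) x u v w = fderiv ℝ (fderiv ℝ (fderiv ℝ f)) x u w v := by
  have hd := (differentiable_fderiv_fderiv hf x).hasFDerivAt
  have h1 := (hd.clm_apply (hasFDerivAt_const v x)).clm_apply (hasFDerivAt_const w x)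
  have h2 := (hd.clm_apply (hasFDerivAt_const w x)).clm_apply (hasFDerivAt_const v x)
  have h3 : (fun y => fderiv ℝ (fderiv ℝ f) y v w) = fun y => fderiv ℝ (fderiv ℝ f) y w v :=
    funext fun y => fderiv_fderiv_symm (hf.of_le (by norm_num)) y v w
  rw [h3] at h1
  simpa using congrArg (fun φ : E →L[ℝ] ℝ => φ u) (h1.unique h2)

theorem abs_fderiv_fderiv_apply_le (f : E → ℝ) (x u v : E) :
    |fderiv ℝ (fderiv ℝ f) x u v| ≤ ‖iteratedFDeriv ℝ 2 f x‖ * (‖u‖ * ‖v‖) := by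
  have := (iteratedFDeriv ℝ 2 f x).le_opNorm ![u, v]
  simpa [iteratedFDeriv_two_apply, Fin.prod_univ_two] using this

theorem abs_fderiv_fderiv_fderiv_apply_le (f : E → ℝ) (x u v w : E) :
    |fderiv ℝ (fderiv ℝ (fderiv ℝ f)) x u v w| ≤
      ‖iteratedFDeriv ℝ 3 f x‖ * (‖u‖ * ‖v‖ * ‖w‖) := by
  have := (iteratedFDeriv ℝ 3 f x).le_opNorm ![u, v, w]
  simpa [iteratedFDeriv_three_apply, Fin.prod_univ_three] using this

theorem abs_fderiv_fderiv_fderiv_sub_apply_le (f : E → ℝ) (x y u v w : E) :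
    |fderiv ℝ (fderiv ℝ (fderiv ℝ f)) y u v w - fderiv ℝ (fderiv ℝ (fderiv ℝ f)) x u v w| ≤
      ‖iteratedFDeriv ℝ 3 f y - iteratedFDeriv ℝ 3 f x‖ * (‖u‖ * ‖v‖ * ‖w‖) := by
  have := (iteratedFDeriv ℝ 3 f y - iteratedFDeriv ℝ 3 f x).le_opNorm ![u, v, w]
  simpa [iteratedFDeriv_three_apply, Fin.prod_univ_three] using this

/-- The Hessian of a convex function is positive semidefinite. -/
theorem fderiv_fderiv_nonneg {f : E → ℝ} (hf : ContDiff ℝ 2 f) (hc : ConvexOn ℝ Set.univ f)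
    (x k : E) : 0 ≤ fderiv ℝ (fderiv ℝ f) x k k := by
  have hd : Differentiable ℝ f := hf.differentiable (by norm_num)
  have hline : ∀ t : ℝ, HasDerivAt (fun s : ℝ => f (x + s • k)) (fderiv ℝ f (x + t • k) k) t :=
    hasDerivAt_comp_line hd x k
  have hconv : ConvexOn ℝ Set.univ (fun s : ℝ => f (x + s • k)) := by
    have h := hc.comp_affineMap (AffineMap.lineMap x (x + k))
    rw [Set.preimage_univ] at h
    refine h.congr fun s _ => ?_
    simp [AffineMap.lineMap_apply, add_comm]
  have hmono : Monotone fun t : ℝ => fderiv ℝ f (x + t • k) k := by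
    have h := hconv.monotoneOn_deriv fun t _ => (hline t).differentiableAt
    intro s t hst
    have := h (Set.mem_univ s) (Set.mem_univ t) hst
    rwa [(hline s).deriv, (hline t).deriv] at this
  have h2 := (hasDerivAt_comp_line
    ((hf.fderiv_right (m := 1) (by norm_num)).differentiable (by norm_num)) x k 0).clm_apply
    (hasDerivAt_const (0 : ℝ) k)
  have h3 := hmono.deriv_nonneg (x := 0)
  rw [h2.deriv] at h3
  simpa using h3

theorem hasDerivAt_hessian_comp_line {f : E → ℝ} (hf : ContDiff ℝ 3 f) (x h k : E) (t : ℝ) :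
    HasDerivAt (fun s : ℝ => fderiv ℝ (fderiv ℝ f) (x + s • h) k k)
      (fderiv ℝ (fderiv ℝ (fderiv ℝ f)) (x + t • h) h k k) t := by
  have h1 := hasDerivAt_comp_line (F := E →L[ℝ] E →L[ℝ] ℝ) (differentiable_fderiv_fderiv hf) x h t
  have h2 := (h1.clm_apply (hasDerivAt_const t k)).clm_apply (hasDerivAt_const t k)
  simpa using h2

/-- The Hölder bound supplies the one missing ingredient, continuity of the top derivative. -/
theorem HolderDeriv.contDiff {E : Type*} [NormedAddCommGroup E] [InnerProductSpace ℝ E]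
    {f : E → ℝ} {p : ℕ} {ν Hf : ℝ} (hf : HolderDeriv f p ν Hf) (hν : 0 < ν) :
    ContDiff ℝ p f := by
  have hcont : Continuous (iteratedFDeriv ℝ p f) := by
    refine continuous_iff_continuousAt.2 fun x => tendsto_iff_norm_sub_tendsto_zero.2 ?_
    refine squeeze_zero (fun _ => norm_nonneg _) (fun y => hf.2 y x) ?_
    have h : Continuous fun y : E => Hf * ‖y - x‖ ^ ν := by
      refine continuous_const.mul (Continuous.rpow_const ?_ fun _ => Or.inr hν.le)
      fun_prop
    simpa [Real.zero_rpow hν.ne'] using h.tendsto x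
  refine contDiff_iff_continuous_differentiable.2 ?_
  refine ⟨fun m hm => ?_, fun m hm => hf.1 m (by exact_mod_cast hm)⟩
  rcases (show m ≤ p by exact_mod_cast hm).lt_or_eq with h | rfl
  · exact (hf.1 m h).continuous
  · exact hcont

/-- For a convex function with Hölder third derivative, the third derivative in any direction is
bounded below by the Hessian up to a power of the norm. -/
theorem HolderDeriv.neg_third_le {E : Type*} [NormedAddCommGroup E] [InnerProductSpace ℝ E]
    {f : E → ℝ} {ν Hf : ℝ} (hf : HolderDeriv f 3 ν Hf) (hν : 0 < ν) (hHf : 0 ≤ Hf)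
    (hc : ConvexOn ℝ Set.univ f) (x h k : E) :
    -fderiv ℝ (fderiv ℝ (fderiv ℝ f)) x h k k ≤
      fderiv ℝ (fderiv ℝ f) x k k + Hf * ‖h‖ ^ (1 + ν) * ‖k‖ ^ 2 := by
  have hC : ContDiff ℝ 3 f := hf.contDiff hν
  have hline := hasDerivAt_hessian_comp_line hC x h k
  obtain ⟨t, ht, hslope⟩ := exists_hasDerivAt_eq_slope _ _ (zero_lt_one (α := ℝ))
    (fun t _ => (hline t).continuousAt.continuousWithinAt) (fun t _ => hline t)
  -- Convexity enters at the far endpoint `x + h`: the Hessian along the segment cannot drop below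
  -- zero there.
  have hpos := fderiv_fderiv_nonneg (hC.of_le (by norm_num)) hc (x + (1 : ℝ) • h) k
  have hdiff := (le_abs_self _).trans
    (abs_fderiv_fderiv_fderiv_sub_apply_le f x (x + t • h) h k k)
  have hbound : ‖iteratedFDeriv ℝ 3 f (x + t • h) - iteratedFDeriv ℝ 3 f x‖ ≤ Hf * ‖h‖ ^ ν := by
    refine (hf.2 _ _).trans (mul_le_mul_of_nonneg_left ?_ hHf)
    refine Real.rpow_le_rpow (norm_nonneg _) ?_ hν.le
    rw [add_sub_cancel_left, norm_smul, Real.norm_of_nonneg ht.1.le]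
    exact mul_le_of_le_one_left (norm_nonneg _) ht.2.le
  have h1 := mul_le_mul_of_nonneg_right hbound
    (by positivity : 0 ≤ ‖h‖ * ‖k‖ * ‖k‖)
  have h2 : Hf * ‖h‖ ^ ν * (‖h‖ * ‖k‖ * ‖k‖) = Hf * ‖h‖ ^ (1 + ν) * ‖k‖ ^ 2 := by
    rw [Real.rpow_add' (norm_nonneg _) (by linarith), Real.rpow_one]; ring
  simp only [zero_smul, add_zero, sub_zero, div_one] at hslope
  linarith

/-- The scaled two-sided bound on the third derivative of a convex function with Hölder third
derivative. -/
theorem HolderDeriv.abs_third_le {E : Type*} [NormedAddCommGroup E] [InnerProductSpace ℝ E]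
    {f : E → ℝ} {ν Hf : ℝ} (hf : HolderDeriv f 3 ν Hf) (hν : 0 < ν) (hHf : 0 ≤ Hf)
    (hc : ConvexOn ℝ Set.univ f) {τ : ℝ} (hτ : 0 < τ) (x h k : E) :
    |fderiv ℝ (fderiv ℝ (fderiv ℝ f)) x h k k| ≤
      1 / τ * fderiv ℝ (fderiv ℝ f) x k k + τ ^ ν * Hf * (‖h‖ ^ (1 + ν) * ‖k‖ ^ 2) := by
  have key : ∀ h : E, -fderiv ℝ (fderiv ℝ (fderiv ℝ f)) x h k k ≤
      1 / τ * fderiv ℝ (fderiv ℝ f) x k k + τ ^ ν * Hf * (‖h‖ ^ (1 + ν) * ‖k‖ ^ 2) := by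
    intro h
    -- The third derivative is linear in `h` while the error grows like ‖h‖^(1+ν); rescaling `h` by
    -- `τ` trades one term for the other.
    have h1 := hf.neg_third_le hν hHf hc x (τ • h) k
    rw [norm_smul, Real.norm_of_nonneg hτ.le, Real.mul_rpow hτ.le (norm_nonneg _),
      Real.rpow_add hτ, Real.rpow_one] at h1
    simp only [map_smul, smul_apply, smul_eq_mul] at h1
    have h2 : τ * (1 / τ * fderiv ℝ (fderiv ℝ f) x k k) = fderiv ℝ (fderiv ℝ f) x k k := by
      field_simp
    refine le_of_mul_le_mul_left ?_ hτ
    linarith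
  refine abs_le'.2 ⟨?_, key h⟩
  simpa using key (-h)

end ThirdOrder

/-! ### Gradients of the model and of the scaling function. -/

theorem hasFDerivAt_linear_sub {E F : Type*} [NormedAddCommGroup E] [NormedSpace ℝ E]
    [NormedAddCommGroup F] [NormedSpace ℝ F] (L : E →L[ℝ] F) (x y : E) :
    HasFDerivAt (fun y : E => L (y - x)) L y :=
  L.hasFDerivAt.comp y ((hasFDerivAt_id y).sub_const x)

theorem hasFDerivAt_bilinear_sub {E : Type*} [NormedAddCommGroup E] [NormedSpace ℝ E]
    (B : E →L[ℝ] E →L[ℝ] ℝ) (x y : E) :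
    HasFDerivAt (fun y : E => B (y - x) (y - x)) (B (y - x) + B.flip (y - x)) y := by
  have hid : HasFDerivAt (fun y : E => y - x) (ContinuousLinearMap.id ℝ E) y :=
    (hasFDerivAt_id y).sub_const x
  have h1 : HasFDerivAt (fun y : E => B (y - x)) B y := hasFDerivAt_linear_sub B x y
  exact h1.clm_apply hid

theorem hasFDerivAt_trilinear_sub {E : Type*} [NormedAddCommGroup E] [NormedSpace ℝ E]
    (S : E →L[ℝ] E →L[ℝ] E →L[ℝ] ℝ) (x y : E) :
    HasFDerivAt (fun y : E => S (y - x) (y - x) (y - x))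
      (S (y - x) (y - x) + (S (y - x) + S.flip (y - x)).flip (y - x)) y := by
  have hid : HasFDerivAt (fun y : E => y - x) (ContinuousLinearMap.id ℝ E) y :=
    (hasFDerivAt_id y).sub_const x
  have h1 : HasFDerivAt (fun y : E => S (y - x)) S y :=
    hasFDerivAt_linear_sub (F := E →L[ℝ] E →L[ℝ] ℝ) S x y
  have h2 : HasFDerivAt (fun y : E => S (y - x) (y - x)) (S (y - x) + S.flip (y - x)) y :=
    h1.clm_apply hid
  exact h2.clm_apply hid

section Models

variable {E : Type*} [NormedAddCommGroup E] [InnerProductSpace ℝ E]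

theorem hasFDerivAt_norm_sub_rpow {ν : ℝ} (hν : 0 < ν) (x y : E) :
    HasFDerivAt (fun y : E => ‖y - x‖ ^ (3 + ν))
      ((3 + ν) • innerSL ℝ (‖y - x‖ ^ (1 + ν) • (y - x))) y := by
  have h1 := (hasFDerivAt_norm_rpow (y - x) (p := 3 + ν) (by linarith)).comp y
    ((hasFDerivAt_id y).sub_const x)
  refine h1.congr_fderiv ?_
  ext v
  rw [show 3 + ν - 2 = 1 + ν by ring]
  simp [mul_assoc]

theorem regModel_eq (f : E → ℝ) (ν H : ℝ) (x y : E) :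
    regModel f 3 ν H x y = f x + fderiv ℝ f x (y - x) +
      1 / 2 * fderiv ℝ (fderiv ℝ f) x (y - x) (y - x) +
      1 / 6 * fderiv ℝ (fderiv ℝ (fderiv ℝ f)) x (y - x) (y - x) (y - x) +
      H / 6 * ‖y - x‖ ^ (3 + ν) := by
  have : Finset.Icc 1 3 = ({1, 2, 3} : Finset ℕ) := rfl
  simp [regModel, taylorModel, this, iteratedFDeriv_one_apply, iteratedFDeriv_two_apply,
    iteratedFDeriv_three_apply, Nat.factorial]
  norm_num
  ring

theorem scaling_eq (f : E → ℝ) (ν : ℝ) (x y : E) :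
    scaling f ν x y = 1 / 2 * fderiv ℝ (fderiv ℝ f) x (y - x) (y - x) +
      1 / (3 + ν) * ‖y - x‖ ^ (3 + ν) := by
  simp [scaling, iteratedFDeriv_two_apply]

theorem differentiable_scaling (f : E → ℝ) {ν : ℝ} (hν : 0 < ν) (x : E) :
    Differentiable ℝ (scaling f ν x) := by
  rw [funext (scaling_eq f ν x)]
  exact fun y => (((hasFDerivAt_bilinear_sub (fderiv ℝ (fderiv ℝ f) x) x y).const_mul _).add
    ((hasFDerivAt_norm_sub_rpow hν x y).const_mul _)).differentiableAt

theorem fderiv_scaling {f : E → ℝ} (hf : ContDiff ℝ 3 f) {ν : ℝ} (hν : 0 < ν) (x y v : E) :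
    fderiv ℝ (scaling f ν x) y v = fderiv ℝ (fderiv ℝ f) x (y - x) v +
      inner ℝ (‖y - x‖ ^ (1 + ν) • (y - x)) v := by
  have hD := ((hasFDerivAt_bilinear_sub (fderiv ℝ (fderiv ℝ f) x) x y).const_mul (1 / 2)).add
    ((hasFDerivAt_norm_sub_rpow hν x y).const_mul (1 / (3 + ν)))
  rw [funext (scaling_eq f ν x)]
  refine (congrArg (fun φ : E →L[ℝ] ℝ => φ v) hD.fderiv).trans ?_
  have h1 := fderiv_fderiv_symm (hf.of_le (by norm_num)) x v (y - x)
  have h2 : 3 + ν ≠ 0 := by linarith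
  simp only [add_apply, smul_apply, ContinuousLinearMap.flip_apply, smul_eq_mul, h1,
    innerSL_apply_apply]
  field_simp
  ring

theorem differentiable_regModel (f : E → ℝ) {ν : ℝ} (hν : 0 < ν) (H : ℝ) (x : E) :
    Differentiable ℝ (regModel f 3 ν H x) := by
  rw [funext (regModel_eq f ν H x)]
  exact fun y => ((((hasFDerivAt_linear_sub (fderiv ℝ f x) x y).const_add (f x)).add
    ((hasFDerivAt_bilinear_sub (fderiv ℝ (fderiv ℝ f) x) x y).const_mul _)).add
    ((hasFDerivAt_trilinear_sub (fderiv ℝ (fderiv ℝ (fderiv ℝ f)) x) x y).const_mul _)).add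
    ((hasFDerivAt_norm_sub_rpow hν x y).const_mul _) |>.differentiableAt

theorem fderiv_regModel {f : E → ℝ} (hf : ContDiff ℝ 3 f) {ν : ℝ} (hν : 0 < ν) (H : ℝ)
    (x y v : E) :
    fderiv ℝ (regModel f 3 ν H x) y v = fderiv ℝ f x v + fderiv ℝ (fderiv ℝ f) x (y - x) v +
      1 / 2 * fderiv ℝ (fderiv ℝ (fderiv ℝ f)) x (y - x) (y - x) v +
      (3 + ν) * H / 6 * inner ℝ (‖y - x‖ ^ (1 + ν) • (y - x)) v := by
  have hD := ((((hasFDerivAt_linear_sub (fderiv ℝ f x) x y).const_add (f x)).add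
    ((hasFDerivAt_bilinear_sub (fderiv ℝ (fderiv ℝ f) x) x y).const_mul (1 / 2))).add
    ((hasFDerivAt_trilinear_sub (fderiv ℝ (fderiv ℝ (fderiv ℝ f)) x) x y).const_mul (1 / 6))).add
    ((hasFDerivAt_norm_sub_rpow hν x y).const_mul (H / 6))
  rw [funext (regModel_eq f ν H x)]
  refine (congrArg (fun φ : E →L[ℝ] ℝ => φ v) hD.fderiv).trans ?_
  have h1 := fderiv_fderiv_symm (hf.of_le (by norm_num)) x v (y - x)
  have h2 := fderiv_fderiv_fderiv_symm' hf x (y - x) v (y - x)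
  have h3 := (fderiv_fderiv_fderiv_symm hf x v (y - x) (y - x)).trans h2
  simp only [add_apply, smul_apply, ContinuousLinearMap.flip_apply, smul_eq_mul, h1, h2, h3,
    innerSL_apply_apply]
  ring

theorem fderiv_scaling_sub {f : E → ℝ} (hf : ContDiff ℝ 3 f) {ν : ℝ} (hν : 0 < ν)
    (x u v w : E) :
    (fderiv ℝ (scaling f ν x) v - fderiv ℝ (scaling f ν x) u) w =
      fderiv ℝ (fderiv ℝ f) x (v - u) w +
      inner ℝ (‖v - x‖ ^ (1 + ν) • (v - x) - ‖u - x‖ ^ (1 + ν) • (u - x)) w := by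
  rw [sub_apply, fderiv_scaling hf hν, fderiv_scaling hf hν, inner_sub_left]
  have : fderiv ℝ (fderiv ℝ f) x (v - u) w =
      fderiv ℝ (fderiv ℝ f) x (v - x) w - fderiv ℝ (fderiv ℝ f) x (u - x) w := by
    rw [← sub_apply, ← map_sub, sub_sub_sub_cancel_right]
  rw [this]
  ring

/-- For a symmetric trilinear form S, ½(S[a,a,·] - S[b,b,·]) at a - b equals S[(a+b)/2, a-b, a-b],
which is where the midpoint comes from. -/
theorem fderiv_regModel_sub {f : E → ℝ} (hf : ContDiff ℝ 3 f) {ν : ℝ} (hν : 0 < ν) (H : ℝ)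
    (x u v : E) :
    (fderiv ℝ (regModel f 3 ν H x) v - fderiv ℝ (regModel f 3 ν H x) u) (v - u) =
      fderiv ℝ (fderiv ℝ f) x (v - u) (v - u) +
      fderiv ℝ (fderiv ℝ (fderiv ℝ f)) x ((1 / 2 : ℝ) • ((v - x) + (u - x))) (v - u) (v - u) +
      (3 + ν) * H / 6 *
        inner ℝ (‖v - x‖ ^ (1 + ν) • (v - x) - ‖u - x‖ ^ (1 + ν) • (u - x)) (v - u) := by
  rw [sub_apply, fderiv_regModel hf hν, fderiv_regModel hf hν, inner_sub_left]
  have hvu : v - u = (v - x) - (u - x) := (sub_sub_sub_cancel_right v u x).symm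
  have h1 := fderiv_fderiv_fderiv_symm hf x (u - x) (v - x) (v - u)
  rw [hvu] at h1 ⊢
  generalize v - x = a at *
  generalize u - x = b at *
  simp only [map_sub, map_add, map_smul, sub_apply, add_apply, smul_apply, smul_eq_mul] at h1 ⊢
  linear_combination (-1 / 2) * h1

end Models

/-! ### The adaptive Bregman gradient method for a general objective. -/

section BregmanGradient

variable {E : Type*} [NormedAddCommGroup E] [InnerProductSpace ℝ E]

theorem bregman_add_bregman (d : E → ℝ) (u v : E) :
    bregman d u v + bregman d v u = (fderiv ℝ d v - fderiv ℝ d u) (v - u) := by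
  have : fderiv ℝ d v (u - v) = -fderiv ℝ d v (v - u) := by rw [← map_neg, neg_sub]
  simp only [bregman, sub_apply, this]
  ring

theorem bregman_three_point (d : E → ℝ) (u v w : E) :
    bregman d u w - bregman d v w - bregman d u v =
      (fderiv ℝ d v - fderiv ℝ d u) (w - v) := by
  simp only [bregman, sub_apply, map_sub]
  ring

theorem fderiv_eq_of_isMinOn_bregman {g d : E → ℝ} (hd : Differentiable ℝ d) {u v : E} {M : ℝ}
    (hmin : IsMinOn (fun w => fderiv ℝ g u (w - u) + M * bregman d u w) Set.univ v) :
    fderiv ℝ g u = -(M • (fderiv ℝ d v - fderiv ℝ d u)) := by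
  have hid : HasFDerivAt (fun w : E => w - u) (ContinuousLinearMap.id ℝ E) v :=
    (hasFDerivAt_id v).sub_const u
  have h2 : HasFDerivAt (fun w => bregman d u w) (fderiv ℝ d v - fderiv ℝ d u) v :=
    ((hd v).hasFDerivAt.sub_const _).sub ((fderiv ℝ d u).hasFDerivAt.comp v hid)
  have h3 : HasFDerivAt (fun w => fderiv ℝ g u (w - u) + M * bregman d u w)
      (fderiv ℝ g u + M • (fderiv ℝ d v - fderiv ℝ d u)) v :=
    ((fderiv ℝ g u).hasFDerivAt.comp v hid).add (h2.const_mul M)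
  exact eq_neg_of_add_eq_zero_left ((hmin.isLocalMin Filter.univ_mem).hasFDerivAt_eq_zero h3)

/-- The accepted steps of the adaptive Bregman gradient method under relative smoothness. -/
theorem IsBregmanGradientRun.exists_steps {g d : E → ℝ} {y₀ : E} {L₀ C : ℝ} {y : ℕ → E}
    (hrun : IsBregmanGradientRun g d y₀ L₀ y) (hd : Differentiable ℝ d)
    (hdpos : ∀ u v, 0 ≤ bregman d u v) (hC : ∀ u v, bregman g u v ≤ C * bregman d u v) :
    ∃ M : ℕ → ℝ, ∀ k, 0 < M k ∧ M k ≤ max L₀ (2 * C) ∧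
      fderiv ℝ g (y k) = -(M k • (fderiv ℝ d (y (k + 1)) - fderiv ℝ d (y k))) ∧
      g (y (k + 1)) ≤ g (y k) + fderiv ℝ g (y k) (y (k + 1) - y k)
        + M k * bregman d (y k) (y (k + 1)) := by
  obtain ⟨hL₀, -, L, i, z, hL0, hstep⟩ := hrun
  have hL : ∀ k, L (k + 1) = 2 ^ i k * L k / 2 := fun k => by
    rw [(hstep k).2.2.2.2, zpow_sub_one₀ (by norm_num), zpow_natCast]; ring
  have hLpos : ∀ k, 0 < L k := by
    intro k
    induction k with
    | zero => rwa [hL0]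
    | succ k ih => rw [hL]; positivity
  have hM : ∀ k, L k ≤ max L₀ (2 * C) → 2 ^ i k * L k ≤ max L₀ (2 * C) := by
    intro k hk
    rcases Nat.eq_zero_or_pos (i k) with h0 | h0
    · simpa [h0] using hk
    -- If the search doubled at least once, the preceding trial was rejected; relative smoothness
    -- would have accepted any constant at least `C`.
    · refine le_max_of_le_right ?_
      by_contra! hlt
      obtain ⟨j, hj⟩ : ∃ j, i k = j + 1 := ⟨i k - 1, by omega⟩
      have hrej := (hstep k).2.1 j (by omega)
      have h1 := hC (y k) (z k j)
      have h2 : C ≤ 2 ^ j * L k := by rw [hj, pow_succ] at hlt; linarith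
      have h3 := mul_le_mul_of_nonneg_right h2 (hdpos (y k) (z k j))
      refine hrej ?_
      have h4 : bregman g (y k) (z k j) =
        g (z k j) - g (y k) - fderiv ℝ g (y k) (z k j - y k) := rfl
      linarith
  have hLle : ∀ k, L k ≤ max L₀ (2 * C) := by
    intro k
    induction k with
    | zero => rw [hL0]; exact le_max_left _ _
    | succ k ih =>
      rw [hL]
      have h1 := hM k ih
      have h2 : 0 < 2 ^ i k * L k := by have := hLpos k; positivity
      linarith
  refine ⟨fun k => 2 ^ i k * L k, fun k => ⟨?_, hM k (hLle k), ?_, ?_⟩⟩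
  · have := hLpos k
    positivity
  · rw [(hstep k).2.2.2.1]
    exact fderiv_eq_of_isMinOn_bregman hd ((hstep k).1 (i k) le_rfl)
  · rw [(hstep k).2.2.2.1]
    exact (hstep k).2.2.1

section Step

variable {g d : E → ℝ} {u v : E} {M : ℝ}

/-- Optimality turns the linear term into -M(β(u,v) + β(v,u)), and the acceptance test cancels
β(u,v). -/
theorem bregman_step_descent
    (hopt : fderiv ℝ g u = -(M • (fderiv ℝ d v - fderiv ℝ d u)))
    (hacc : g v ≤ g u + fderiv ℝ g u (v - u) + M * bregman d u v) :
    g v + M * bregman d v u ≤ g u := by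
  have h1 := congrArg (M * ·) (bregman_add_bregman d u v)
  rw [hopt, neg_apply, smul_apply, smul_eq_mul] at hacc
  linarith

/-- Convexity bounds `g w` below by its linearization at `u`; optimality and the three-point
identity convert the linear term into Bregman distances. -/
theorem bregman_step_convex (hg : ∀ u v, 0 ≤ bregman g u v)
    (hopt : fderiv ℝ g u = -(M • (fderiv ℝ d v - fderiv ℝ d u)))
    (hacc : g v ≤ g u + fderiv ℝ g u (v - u) + M * bregman d u v) (w : E) :
    g v - g w ≤ M * (bregman d u w - bregman d v w) := by
  have h1 := congrArg (M * ·) (bregman_three_point d u v w)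
  have h2 := hg u w
  have h3 : fderiv ℝ g u (w - v) = fderiv ℝ g u (w - u) - fderiv ℝ g u (v - u) := by
    rw [← map_sub, sub_sub_sub_cancel_right]
  have h4 : fderiv ℝ g u (w - v) = -(M * (fderiv ℝ d v - fderiv ℝ d u) (w - v)) := by
    rw [hopt, neg_apply, smul_apply, smul_eq_mul]
  simp only [bregman] at h2
  linarith

/-- A step with a large gradient decreases the objective when `d` is uniformly convex with locally
Lipschitz gradient. -/
theorem bregman_step_decrease {q c N ε Mbar : ℝ} (hq : 1 ≤ q) (hc : 0 ≤ c) (hN : 0 < N)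
    (hε : 0 ≤ ε) (hM : 0 < M) (hMbar : M ≤ Mbar)
    (huc : c * ‖u - v‖ ^ q ≤ bregman d v u)
    (hlip : ‖fderiv ℝ d v - fderiv ℝ d u‖ ≤ N * ‖u - v‖)
    (hopt : fderiv ℝ g u = -(M • (fderiv ℝ d v - fderiv ℝ d u)))
    (hacc : g v ≤ g u + fderiv ℝ g u (v - u) + M * bregman d u v)
    (hgrad : ε ≤ ‖fderiv ℝ g u‖) :
    g v + c * (ε / N) ^ q / Mbar ^ (q - 1) ≤ g u := by
  refine le_trans (add_le_add le_rfl ?_) (bregman_step_descent hopt hacc)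
  have h1 : ε / N ≤ M * ‖u - v‖ := by
    rw [hopt, norm_neg, norm_smul, Real.norm_of_nonneg hM.le] at hgrad
    rw [div_le_iff₀ hN]
    have := mul_le_mul_of_nonneg_left hlip hM.le
    linarith
  have h2 : (ε / N) ^ q ≤ M * M ^ (q - 1) * ‖u - v‖ ^ q := by
    have := Real.rpow_le_rpow (by positivity) h1 (by linarith : 0 ≤ q)
    rw [Real.mul_rpow hM.le (norm_nonneg _)] at this
    have h3 : M ^ q = M * M ^ (q - 1) := by
      rw [← Real.rpow_one_add' hM.le (by linarith)]; congr 1; ring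
    rwa [h3] at this
  have hMb : 0 < Mbar := hM.trans_le hMbar
  rw [div_le_iff₀ (by positivity)]
  have h4 : M ^ (q - 1) ≤ Mbar ^ (q - 1) := Real.rpow_le_rpow hM.le hMbar (by linarith)
  calc c * (ε / N) ^ q ≤ c * (M * M ^ (q - 1) * ‖u - v‖ ^ q) := mul_le_mul_of_nonneg_left h2 hc
    _ = M * (c * ‖u - v‖ ^ q) * M ^ (q - 1) := by ring
    _ ≤ M * bregman d v u * Mbar ^ (q - 1) := by
      have h5 : 0 ≤ c * ‖u - v‖ ^ q := by positivity
      have h6 := mul_nonneg hM.le (h5.trans huc)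
      gcongr

end Step

theorem mul_le_sub_of_decrease {a : ℕ → ℝ} {δ : ℝ} {T : ℕ} (h : ∀ k ≤ T, a (k + 1) + δ ≤ a k)
    (K n : ℕ) (hn : K + n ≤ T + 1) : n * δ ≤ a K - a (K + n) := by
  induction n with
  | zero => simp
  | succ n ih =>
    have h1 := ih (by omega)
    have h2 := h (K + n) (by omega)
    rw [← add_assoc]
    push_cast
    linarith

/-- Telescoping for a nonincreasing sequence whose gap is controlled by a decreasing potential. -/
theorem mul_gap_le_of_potential {a b M : ℕ → ℝ} {s Mbar : ℝ} (hanti : Antitone a) (hb : ∀ k, 0 ≤ b k)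
    (hM : ∀ k, 0 < M k) (hMbar : ∀ k, M k ≤ Mbar)
    (h : ∀ k, a (k + 1) - s ≤ M k * (b k - b (k + 1))) (K : ℕ) (hs : s ≤ a K) :
    K * (a K - s) ≤ Mbar * b 0 := by
  have key : ∀ n ≤ K, n * (a K - s) ≤ Mbar * (b 0 - b n) := by
    intro n
    induction n with
    | zero => simp
    | succ n ih =>
      intro hn
      have h1 := ih (by omega)
      have h2 : a K - s ≤ M n * (b n - b (n + 1)) :=
        (sub_le_sub_right (hanti hn) s).trans (h n)
      -- The potential must not increase, since otherwise `M n` could not be replaced by `Mbar`.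
      have h3 : 0 ≤ b n - b (n + 1) := nonneg_of_mul_nonneg_right
        ((sub_nonneg.2 hs).trans h2) (hM n)
      have h4 := mul_le_mul_of_nonneg_right (hMbar n) h3
      push_cast
      linarith
  have h1 := key K le_rfl
  have h2 : 0 ≤ Mbar * b K := mul_nonneg ((hM 0).le.trans (hMbar 0)) (hb K)
  linarith

end BregmanGradient

/-! ### Relative smoothness, convexity and size bounds for the third-order model. -/

section Estimates

variable {E : Type*} [NormedAddCommGroup E] [InnerProductSpace ℝ E]

theorem tauH_pos {ν Hf H : ℝ} (hν : 0 < ν) (hHf : 0 < Hf) (hH : 0 < H) : 0 < tauH ν Hf H :=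
  Real.rpow_pos_of_pos (by positivity) _

/-- This identity is what determines τ_H: it writes the regularizer's gradient coefficient as
τ^(1+ν) Hf. -/
theorem tauH_mul_rpow_mul {ν Hf H : ℝ} (hν : 0 < ν) (hHf : 0 < Hf) (hH : 0 < H) :
    tauH ν Hf H * tauH ν Hf H ^ ν * Hf = (3 + ν) * H / 6 := by
  rw [← Real.rpow_one_add' (tauH_pos hν hHf hH).le (by linarith), tauH,
    ← Real.rpow_mul (by positivity), one_div_mul_cancel (by linarith), Real.rpow_one]
  field_simp

theorem regModel_self (f : E → ℝ) {ν : ℝ} (hν : 0 < ν) (H : ℝ) (x : E) :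
    regModel f 3 ν H x x = f x := by
  rw [regModel_eq]
  simp [Real.zero_rpow (by linarith : 3 + ν ≠ 0)]

/-- The regularized model is smooth relative to the scaling function. -/
theorem HolderDeriv.bregman_regModel_le {f : E → ℝ} {ν Hf H : ℝ} (hf : HolderDeriv f 3 ν Hf)
    (hν : 0 < ν) (hHf : 0 < Hf) (hH : 0 < H) (hc : ConvexOn ℝ Set.univ f) (x u v : E) :
    bregman (regModel f 3 ν H x) u v ≤ smoothConst ν Hf H * bregman (scaling f ν x) u v := by
  have hC : ContDiff ℝ 3 f := hf.contDiff hν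
  set τ := tauH ν Hf H
  have hτ : 0 < τ := tauH_pos hν hHf hH
  set L := smoothConst ν Hf H
  have hdρ := differentiable_scaling f hν x
  have hdΩ := differentiable_regModel f hν H x
  have hfd : ∀ w, fderiv ℝ (fun y => L * scaling f ν x y - regModel f 3 ν H x y) w =
      L • fderiv ℝ (scaling f ν x) w - fderiv ℝ (regModel f 3 ν H x) w := fun w =>
    (((hdρ w).hasFDerivAt.const_mul L).sub (hdΩ w).hasFDerivAt).fderiv
  have hnonneg := bregman_nonneg_of_gradient_monotone
    (g := fun y => L * scaling f ν x y - regModel f 3 ν H x y)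
    ((hdρ.const_mul L).sub hdΩ) (fun u v => ?_) u v
  · simp only [bregman, hfd, sub_apply, smul_apply, smul_eq_mul] at hnonneg ⊢
    linarith
  · have h1 := fderiv_scaling_sub hC hν x u v (v - u)
    have h2 := fderiv_regModel_sub hC hν H x u v
    have h3 := (le_abs_self _).trans
      (hf.abs_third_le hν hHf.le hc hτ x ((1 / 2 : ℝ) • ((v - x) + (u - x))) (v - u))
    have h4 := norm_midpoint_rpow_mul_le_inner (s := 1 + ν) (by linarith) (v - x) (u - x)
    rw [sub_sub_sub_cancel_right] at h4
    have hA := fderiv_fderiv_nonneg (hC.of_le (by norm_num)) hc x (v - u)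
    have h5 : 0 ≤ ‖(1 / 2 : ℝ) • ((v - x) + (u - x))‖ ^ (1 + ν) * ‖v - u‖ ^ 2 := by positivity
    rw [hfd, hfd]
    simp only [sub_apply, smul_apply, smul_eq_mul] at h1 h2 ⊢
    generalize inner ℝ (‖v - x‖ ^ (1 + ν) • (v - x) - ‖u - x‖ ^ (1 + ν) • (u - x)) (v - u) = P at *
    generalize ‖(1 / 2 : ℝ) • ((v - x) + (u - x))‖ ^ (1 + ν) * ‖v - u‖ ^ 2 = Q at *
    generalize fderiv ℝ (fderiv ℝ f) x (v - u) (v - u) = A at *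
    have hL1 : 1 + 1 / τ ≤ L := by
      have : (τ + 1) / τ = 1 + 1 / τ := by field_simp
      exact this ▸ le_max_left _ _
    have hL2 : τ ^ ν * (τ + 1) * Hf ≤ L := le_max_right _ _
    have h6 := mul_le_mul_of_nonneg_right hL1 hA
    have h7 := mul_le_mul_of_nonneg_right hL2 (h5.trans h4)
    have h8 : τ ^ ν * Hf * Q ≤ τ ^ ν * Hf * P := mul_le_mul_of_nonneg_left h4 (by positivity)
    have h9 : τ * τ ^ ν * Hf = (3 + ν) * H / 6 := tauH_mul_rpow_mul hν hHf hH
    rw [← h9] at h2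
    have h10 := congrArg (L * ·) h1
    linarith

/-- At the critical regularization level the model is convex. -/
theorem HolderDeriv.bregman_regModel_nonneg {f : E → ℝ} {ν Hf H : ℝ} (hf : HolderDeriv f 3 ν Hf)
    (hν : 0 < ν) (hHf : 0 < Hf) (hc : ConvexOn ℝ Set.univ f) (hH : H = 6 / (3 + ν) * Hf)
    (x u v : E) : 0 ≤ bregman (regModel f 3 ν H x) u v := by
  have hC : ContDiff ℝ 3 f := hf.contDiff hν
  refine bregman_nonneg_of_gradient_monotone (differentiable_regModel f hν H x)
    (fun u v => ?_) u v
  have h2 := fderiv_regModel_sub hC hν H x u v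
  have h3 := (neg_le_abs _).trans
    (hf.abs_third_le hν hHf.le hc one_pos x ((1 / 2 : ℝ) • ((v - x) + (u - x))) (v - u))
  have h4 := norm_midpoint_rpow_mul_le_inner (s := 1 + ν) (by linarith) (v - x) (u - x)
  rw [sub_sub_sub_cancel_right] at h4
  have h5 := mul_le_mul_of_nonneg_left h4 hHf.le
  have h6 : (3 + ν) * H / 6 = Hf := by
    have : 3 + ν ≠ 0 := by linarith
    rw [hH]; field_simp
  rw [h6] at h2
  rw [Real.one_rpow, one_mul, one_div_one, one_mul] at h3
  linarith

/-- The quadratic part of ρ only helps, so the power of the norm alone gives uniform convexity. -/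
theorem le_bregman_scaling {f : E → ℝ} {ν : ℝ} (hf : ContDiff ℝ 3 f) (hν : 0 < ν)
    (hc : ConvexOn ℝ Set.univ f) (x u v : E) :
    (2 : ℝ) ^ (-(1 + ν)) / (3 + ν) * ‖v - u‖ ^ (3 + ν) ≤ bregman (scaling f ν x) u v := by
  refine le_bregman_of_gradient_monotone (differentiable_scaling f hν x) (by linarith)
    (fun u v => ?_) u v
  have h1 := two_rpow_mul_norm_rpow_le_inner (s := 1 + ν) (by linarith) (v - x) (u - x)
  rw [sub_sub_sub_cancel_right, show 1 + ν + 2 = 3 + ν by ring] at h1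
  rw [fderiv_scaling_sub hf hν]
  linarith [fderiv_fderiv_nonneg (hf.of_le (by norm_num)) hc x (v - u)]

theorem norm_fderiv_scaling_sub_le {f : E → ℝ} {ν D : ℝ} (hf : ContDiff ℝ 3 f) (hν : 0 < ν)
    (hν1 : ν ≤ 1) (hD : 1 ≤ D) {x u v : E} (hu : ‖u - x‖ ≤ D) (hv : ‖v - x‖ ≤ D) :
    ‖fderiv ℝ (scaling f ν x) v - fderiv ℝ (scaling f ν x) u‖ ≤
      (‖iteratedFDeriv ℝ 2 f x‖ + (2 + ν) * D ^ 2) * ‖v - u‖ := by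
  refine ContinuousLinearMap.opNorm_le_bound _ (by positivity) fun w => ?_
  rw [fderiv_scaling_sub hf hν]
  refine (abs_add_le _ _).trans ?_
  have h1 := abs_fderiv_fderiv_apply_le f x (v - u) w
  have h2 := abs_real_inner_le_norm
    (‖v - x‖ ^ (1 + ν) • (v - x) - ‖u - x‖ ^ (1 + ν) • (u - x)) w
  have h3 := norm_rpow_smul_sub_le (s := 1 + ν) (by linarith) hv hu
  rw [sub_sub_sub_cancel_right] at h3
  have h4 : D ^ (1 + ν) ≤ D ^ 2 := by
    rw [← Real.rpow_two]; exact Real.rpow_le_rpow_of_exponent_le hD (by linarith)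
  have h5 : (1 + (1 + ν)) * D ^ (1 + ν) * ‖v - u‖ ≤ (2 + ν) * D ^ 2 * ‖v - u‖ := by
    rw [← add_assoc, one_add_one_eq_two]; gcongr
  have h6 := mul_le_mul_of_nonneg_right (h3.trans h5) (norm_nonneg w)
  linarith

theorem one_le_constD (f : E → ℝ) (ν H : ℝ) (x : E) : 1 ≤ constD f ν H x :=
  (le_max_left _ _).trans (le_max_left _ _)

/-- The sublevel set of the regularized model at `x` lies in the ball of radius `constD`. -/
theorem norm_sub_le_constD {f : E → ℝ} {ν H : ℝ} (hν : 0 < ν) (hH : 0 < H) {x y : E}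
    (h : regModel f 3 ν H x y ≤ f x) : ‖y - x‖ ≤ constD f ν H x := by
  by_contra! hlt
  set r := ‖y - x‖
  have hr1 : 1 < r := (one_le_constD f ν H x).trans_lt hlt
  have hr0 : 0 < r := by linarith
  have h1 : 6 * ‖fderiv ℝ f x‖ ≤ H * r ^ 2 := by
    have h0 : (6 * ‖fderiv ℝ f x‖ / H) ^ (1 / 2 : ℝ) ≤ r :=
      ((le_max_right _ _).trans (le_max_left _ _)).trans hlt.le
    rw [← Real.sqrt_eq_rpow, Real.sqrt_le_left hr0.le, div_le_iff₀ hH] at h0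
    linarith
  have h2 : 3 * ‖iteratedFDeriv ℝ 2 f x‖ ≤ H * r := by
    have h0 : 3 * ‖iteratedFDeriv ℝ 2 f x‖ / H ≤ r :=
      ((le_max_left _ _).trans (le_max_right _ _)).trans hlt.le
    rw [div_le_iff₀ hH] at h0
    linarith
  have h3 : 3 * H + ‖iteratedFDeriv ℝ 3 f x‖ ≤ H * r ^ ν := by
    have h0 : (3 + ‖iteratedFDeriv ℝ 3 f x‖ / H) ^ (1 / ν) ≤ r :=
      ((le_max_right _ _).trans (le_max_right _ _)).trans hlt.le
    rw [one_div, Real.rpow_inv_le_iff_of_pos (by positivity) hr0.le hν] at h0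
    have := mul_le_mul_of_nonneg_left h0 hH.le
    rwa [mul_add, mul_div_cancel₀ _ hH.ne', mul_comm H 3] at this
  rw [regModel_eq, Real.rpow_add hr0, show (3 : ℝ) = ((3 : ℕ) : ℝ) by norm_num,
    Real.rpow_natCast] at h
  have b1 : |fderiv ℝ f x (y - x)| ≤ ‖fderiv ℝ f x‖ * r := (fderiv ℝ f x).le_opNorm _
  have b2 := abs_fderiv_fderiv_apply_le f x (y - x) (y - x)
  have b3 := abs_fderiv_fderiv_fderiv_apply_le f x (y - x) (y - x) (y - x)
  have c1 := mul_le_mul_of_nonneg_right h1 hr0.le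
  have c2 := mul_le_mul_of_nonneg_right h2 (mul_pos hr0 hr0).le
  have c3 := mul_le_mul_of_nonneg_right h3 (pow_pos hr0 3).le
  have c4 : 0 < H * r ^ 3 := by positivity
  have d1 := neg_abs_le (fderiv ℝ f x (y - x))
  have d2 := neg_abs_le (fderiv ℝ (fderiv ℝ f) x (y - x) (y - x))
  have d3 := neg_abs_le (fderiv ℝ (fderiv ℝ (fderiv ℝ f)) x (y - x) (y - x) (y - x))
  have e3 : ‖iteratedFDeriv ℝ 3 f x‖ * (r * r * r) = ‖iteratedFDeriv ℝ 3 f x‖ * r ^ 3 := by ring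
  have b3' := b3.trans_eq e3
  -- With r > D, the linear and quadratic terms each cost at most Hr³/6, and the regularizer exceeds
  -- the cubic term by at least Hr³/2. This leaves Ω(y) - f(x) ≥ Hr³/6 > 0.
  linarith

theorem sub_regModel_le_constF {f : E → ℝ} {ν H : ℝ} (hH : 0 < H) {x y : E}
    (hy : ‖y - x‖ ≤ constD f ν H x) : f x - regModel f 3 ν H x y ≤ constF f ν H x := by
  have hD0 : 0 ≤ constD f ν H x := zero_le_one.trans (one_le_constD f ν H x)
  rw [regModel_eq, constF]
  have b1 : |fderiv ℝ f x (y - x)| ≤ ‖fderiv ℝ f x‖ * constD f ν H x :=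
    ((fderiv ℝ f x).le_opNorm _).trans (mul_le_mul_of_nonneg_left hy (norm_nonneg _))
  have b2 : |fderiv ℝ (fderiv ℝ f) x (y - x) (y - x)| ≤
      ‖iteratedFDeriv ℝ 2 f x‖ * (constD f ν H x * constD f ν H x) :=
    (abs_fderiv_fderiv_apply_le f x (y - x) (y - x)).trans (by gcongr)
  have b3 : |fderiv ℝ (fderiv ℝ (fderiv ℝ f)) x (y - x) (y - x) (y - x)| ≤
      ‖iteratedFDeriv ℝ 3 f x‖ * (constD f ν H x * constD f ν H x * constD f ν H x) :=
    (abs_fderiv_fderiv_fderiv_apply_le f x (y - x) (y - x) (y - x)).trans (by gcongr)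
  have d1 := neg_abs_le (fderiv ℝ f x (y - x))
  have d2 := neg_abs_le (fderiv ℝ (fderiv ℝ f) x (y - x) (y - x))
  have d3 := neg_abs_le (fderiv ℝ (fderiv ℝ (fderiv ℝ f)) x (y - x) (y - x) (y - x))
  have h0 : 0 ≤ H / 6 * ‖y - x‖ ^ (3 + ν) := by positivity
  have h3 : 0 ≤ ‖iteratedFDeriv ℝ 3 f x‖ *
    (constD f ν H x * constD f ν H x * constD f ν H x) := by positivity
  linarith

theorem constN_pos (f : E → ℝ) {ν : ℝ} (hν : 0 < ν) (H : ℝ) (x : E) : 0 < constN f ν H x := by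
  have := one_le_constD f ν H x
  rw [constN]
  positivity

theorem bregman_scaling_le {f : E → ℝ} {ν H : ℝ} (hf : ContDiff ℝ 3 f) (hν : 0 < ν)
    (hν1 : ν ≤ 1) {x y : E} (hy : ‖y - x‖ ≤ constD f ν H x) :
    bregman (scaling f ν x) x y ≤ constN f ν H x ^ 2 / 8 := by
  have hD1 := one_le_constD f ν H x
  have hD0 : 0 ≤ constD f ν H x := zero_le_one.trans hD1
  have h1 : fderiv ℝ (scaling f ν x) x (y - x) = 0 := by
    rw [fderiv_scaling hf hν]; simp
  have h2 : scaling f ν x x = 0 := by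
    rw [scaling_eq]; simp [Real.zero_rpow (by linarith : 3 + ν ≠ 0)]
  rw [bregman, h1, h2, sub_zero, sub_zero, scaling_eq, constN]
  have b2 : |fderiv ℝ (fderiv ℝ f) x (y - x) (y - x)| ≤
      ‖iteratedFDeriv ℝ 2 f x‖ * (constD f ν H x * constD f ν H x) :=
    (abs_fderiv_fderiv_apply_le f x (y - x) (y - x)).trans (by gcongr)
  have b3 : ‖y - x‖ ^ (3 + ν) ≤ constD f ν H x ^ 4 := by
    refine (Real.rpow_le_rpow (norm_nonneg _) hy (by linarith)).trans ?_
    rw [← Real.rpow_natCast]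
    exact Real.rpow_le_rpow_of_exponent_le hD1 (by norm_num; linarith)
  have b4 : 1 / (3 + ν) * ‖y - x‖ ^ (3 + ν) ≤ 1 / 3 * constD f ν H x ^ 4 := by
    gcongr
    linarith
  have h5 := (le_abs_self _).trans b2
  have h6 : 0 ≤ ‖iteratedFDeriv ℝ 2 f x‖ := norm_nonneg _
  generalize constD f ν H x = D at *
  generalize ‖iteratedFDeriv ℝ 2 f x‖ = a at *
  -- Since ρ and its gradient vanish at `x`, the distance is at most aD²/2 + D⁴/3, and (a + 2D²)²/8
  -- already dominates this.
  have h7 : (a + 2 * D ^ 2) ^ 2 ≤ (a + (2 + ν) * D ^ 2) ^ 2 := by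
    gcongr
    linarith
  have h8 : 0 ≤ D ^ 4 := by positivity
  have h9 : 0 ≤ a ^ 2 := sq_nonneg a
  have h10 : (a + 2 * D ^ 2) ^ 2 = a ^ 2 + 4 * (a * (D * D)) + 4 * D ^ 4 := by ring
  linarith

end Estimates

end TensorModel

/-! ### The two complexity bounds. -/

theorem mainTheorem3 {E : Type*} [NormedAddCommGroup E] [InnerProductSpace ℝ E]
    [FiniteDimensional ℝ E] (f : E → ℝ) (ν Hf : ℝ) (hν0 : 0 ≤ ν) (hν1 : ν ≤ 1) (hν : ν ≠ 0)
    (hconv : ConvexOn ℝ Set.univ f) (hf : TensorModel.HolderDeriv f 3 ν Hf)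
    (x : E) (H : ℝ) (hH : 0 < H) (L₀ : ℝ) (y : ℕ → E)
    (hy : TensorModel.IsModelRun f ν H x L₀ y)
    (ε : ℝ) (hε0 : 0 < ε) (hε1 : ε < 1) (T : ℕ)
    (hT : ∀ k ≤ T, ε < ‖fderiv ℝ (TensorModel.regModel f 3 ν H x) (y k)‖) :
    (H < 6 / (3 + ν) * Hf →
      (T : ℝ) ≤
        TensorModel.constN f ν H x ^ (3 + ν) * (3 + ν) * TensorModel.constM ν Hf H L₀ ^ (2 + ν)
            * TensorModel.constF f ν H x / (2 : ℝ) ^ (-(1 + ν))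
          * ε ^ (-(3 + ν))) ∧
    (H = 6 / (3 + ν) * Hf →
      (T : ℝ) ≤
        3 * (TensorModel.constM ν Hf H L₀ * TensorModel.constN f ν H x) ^ ((3 + ν) / 2)
          * ((3 + ν) * TensorModel.constN f ν H x ^ 2 / (2 : ℝ) ^ (-(2 + ν))) ^ (1 / 2 : ℝ)
          * ε ^ (-((3 + ν) / 2))) := by
  open TensorModel in
  have hνpos : 0 < ν := lt_of_le_of_ne hν0 hν.symm
  have hC : ContDiff ℝ 3 f := hf.contDiff hνpos
  have hNpos := constN_pos f hνpos H x
  set N := constN f ν H x with hN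
  set M := constM ν Hf H L₀ with hM
  set g := regModel f 3 ν H x with hg
  set δ : ℝ := (2 : ℝ) ^ (-(1 + ν)) / (3 + ν) * (ε / N) ^ (3 + ν) / M ^ (3 + ν - 1) with hδ
  -- the consequences of the accepted steps
  have main : H ≤ 6 / (3 + ν) * Hf → 0 < Hf ∧ 0 < M ∧ (∀ k, ‖y k - x‖ ≤ constD f ν H x) ∧
      (∀ k ≤ T, g (y (k + 1)) + δ ≤ g (y k)) ∧
      ((∀ u v, 0 ≤ bregman g u v) → ∀ K ≤ T + 1,
        K * (g (y K) - g (y (T + 1))) ≤ M * bregman (scaling f ν x) x (y (T + 1))) := by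
    intro hle
    have hHf : 0 < Hf := by
      have h1 : 0 < 6 / (3 + ν) := by positivity
      exact pos_of_mul_pos_right (hH.trans_le hle) h1.le
    have hρ : ∀ u v, 0 ≤ bregman (scaling f ν x) u v := fun u v =>
      le_trans (by positivity) (le_bregman_scaling hC hνpos hconv x u v)
    have hL₀ : 0 < L₀ := hy.1
    have hy0 : y 0 = x := hy.2.1
    obtain ⟨Mk, hMk⟩ := hy.exists_steps (differentiable_scaling f hνpos x) hρ
      (hf.bregman_regModel_le hνpos hHf hH hconv x)
    have hLpos : 0 < smoothConst ν Hf H := by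
      have := tauH_pos hνpos hHf hH
      exact lt_max_of_lt_left (by positivity)
    have hMpos : 0 < M := lt_max_of_lt_left (by positivity)
    have hMle : ∀ k, Mk k ≤ M := fun k =>
      (hMk k).2.1.trans (max_le_max (by linarith) (by linarith))
    have hdesc : ∀ k, g (y (k + 1)) ≤ g (y k) := fun k => by
      have h1 := bregman_step_descent (hMk k).2.2.1 (hMk k).2.2.2
      have h2 := mul_nonneg (hMk k).1.le (hρ (y (k + 1)) (y k))
      linarith
    have hanti : Antitone fun k => g (y k) := antitone_nat_of_succ_le hdesc
    have hball : ∀ k, ‖y k - x‖ ≤ constD f ν H x := fun k => by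
      refine norm_sub_le_constD hνpos hH ((hanti (Nat.zero_le k)).trans_eq ?_)
      simp only [hy0, hg, regModel_self f hνpos]
    refine ⟨hHf, hMpos, hball, fun k hk => ?_, fun hgc K hK => ?_⟩
    · refine bregman_step_decrease (by linarith) (by positivity) hNpos hε0.le (hMk k).1 (hMle k)
        (le_bregman_scaling hC hνpos hconv x _ _) ?_ (hMk k).2.2.1 (hMk k).2.2.2 (hT k hk).le
      rw [norm_sub_rev (y k)]
      exact norm_fderiv_scaling_sub_le hC hνpos hν1 (one_le_constD f ν H x) (hball k)
        (hball (k + 1))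
    -- The comparison point is the last iterate, so no minimizer of the model is needed.
    · have h1 := mul_gap_le_of_potential (a := fun k => g (y k))
        (b := fun k => bregman (scaling f ν x) (y k) (y (T + 1))) hanti (fun k => hρ _ _)
        (fun k => (hMk k).1) hMle
        (fun k => bregman_step_convex hgc (hMk k).2.2.1 (hMk k).2.2.2 _) K (hanti hK)
      rwa [hy0] at h1
  have hδe : H ≤ 6 / (3 + ν) * Hf → 0 < δ ∧
      1 / δ = N ^ (3 + ν) * (3 + ν) * M ^ (2 + ν) / (2 : ℝ) ^ (-(1 + ν)) * ε ^ (-(3 + ν)) := by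
    intro hle
    have hMpos := (main hle).2.1
    refine ⟨by positivity, ?_⟩
    rw [hδ, Real.div_rpow hε0.le hNpos.le, Real.rpow_neg hε0.le,
      show 3 + ν - 1 = 2 + ν by ring]
    have h1 : 0 < M ^ (2 + ν) := by positivity
    have h2 : 0 < N ^ (3 + ν) := by positivity
    have h3 : 0 < ε ^ (3 + ν) := by positivity
    have h4 : (0 : ℝ) < 2 ^ (-(1 + ν)) := by positivity
    field_simp
  constructor
  · intro hlt
    obtain ⟨-, hMpos, hball, hdec, -⟩ := main hlt.le
    obtain ⟨hδpos, hδeq⟩ := hδe hlt.le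
    have h1 := mul_le_sub_of_decrease (a := fun k => g (y k)) hdec 0 (T + 1) (by omega)
    have h2 : g (y 0) - g (y (0 + (T + 1))) ≤ constF f ν H x := by
      rw [show y 0 = x from hy.2.1, hg, regModel_self f hνpos]
      exact sub_regModel_le_constF hH (hball _)
    push_cast at h1
    have h3 : (T : ℝ) ≤ constF f ν H x * (1 / δ) := by
      rw [mul_one_div, le_div_iff₀ hδpos]
      linarith
    rw [hδeq] at h3
    refine h3.trans_eq (by ring)
  · intro heq
    obtain ⟨hHf, hMpos, hball, hdec, hconvex⟩ := main heq.le
    obtain ⟨hδpos, hδeq⟩ := hδe heq.le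
    -- The T + 1 steps are split in half: `J` steps of decrease δ fit into a gap whose product with
    -- `K` is at most MN²/8.
    obtain ⟨K, J, hKJ, hK, hJ⟩ : ∃ K J : ℕ, K + J = T + 1 ∧ T ≤ 2 * K ∧ T ≤ 2 * J :=
      ⟨(T + 1) / 2, T + 1 - (T + 1) / 2, by omega, by omega, by omega⟩
    have h1 := mul_le_sub_of_decrease (a := fun k => g (y k)) hdec K J hKJ.le
    have h2 := hconvex (hf.bregman_regModel_nonneg hνpos hHf hconv heq x) K (by omega)
    have h3 := mul_le_mul_of_nonneg_left (bregman_scaling_le hC hνpos hν1 (hball (T + 1)))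
      hMpos.le
    rw [hKJ] at h1
    have h4 := mul_le_mul_of_nonneg_left h1 (Nat.cast_nonneg (α := ℝ) K)
    have hK' : (T : ℝ) ≤ 2 * K := by exact_mod_cast hK
    have hJ' : (T : ℝ) ≤ 2 * J := by exact_mod_cast hJ
    have h5 : (T : ℝ) ^ 2 ≤ 4 * (K * J) := by
      have := mul_le_mul hK' hJ' (Nat.cast_nonneg T) (by positivity)
      linarith
    have h6 : (T : ℝ) ^ 2 ≤ M * N ^ 2 / 2 * (1 / δ) := by
      rw [mul_one_div, le_div_iff₀ hδpos]
      have := mul_le_mul_of_nonneg_right h5 hδpos.le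
      linarith
    have hsq : ∀ {a : ℝ} (r : ℝ), 0 ≤ a → (a ^ (r / 2)) ^ 2 = a ^ r := fun {a} r ha => by
      rw [← Real.rpow_natCast, ← Real.rpow_mul ha]; congr 1; push_cast; ring
    refine (pow_le_pow_iff_left₀ (Nat.cast_nonneg T) (by positivity) two_ne_zero).1
      (h6.trans ?_)
    rw [hδeq, mul_pow, mul_pow, mul_pow, hsq _ (by positivity), hsq _ (by positivity),
      show -((3 + ν) / 2) = -(3 + ν) / 2 by ring, hsq _ hε0.le, Real.rpow_one,
      Real.mul_rpow hMpos.le hNpos.le, show 3 + ν = 1 + (2 + ν) by ring,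
      Real.rpow_add hMpos 1 (2 + ν), Real.rpow_one, show -(2 + ν) = -(1 + ν) - 1 by ring,
      Real.rpow_sub_one two_ne_zero]
    -- After squaring, both sides are multiples of this quantity: ½ on the left and 18 on the right.
    have h7 : 0 ≤ M * M ^ (2 + ν) * N ^ (1 + (2 + ν)) * (1 + (2 + ν)) * N ^ 2 /
      2 ^ (-(1 + ν)) * ε ^ (-(1 + (2 + ν))) := by positivity
    have h8 : M * N ^ 2 / 2 * (N ^ (1 + (2 + ν)) * (1 + (2 + ν)) * M ^ (2 + ν) /
        2 ^ (-(1 + ν)) * ε ^ (-(1 + (2 + ν)))) =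
      1 / 2 * (M * M ^ (2 + ν) * N ^ (1 + (2 + ν)) * (1 + (2 + ν)) * N ^ 2 /
      2 ^ (-(1 + ν)) * ε ^ (-(1 + (2 + ν)))) := by ring
    have h9 : 3 ^ 2 * (M * M ^ (2 + ν) * N ^ (1 + (2 + ν))) *
        ((1 + (2 + ν)) * N ^ 2 / (2 ^ (-(1 + ν)) / 2)) * ε ^ (-(1 + (2 + ν))) =
      18 * (M * M ^ (2 + ν) * N ^ (1 + (2 + ν)) * (1 + (2 + ν)) * N ^ 2 /
      2 ^ (-(1 + ν)) * ε ^ (-(1 + (2 + ν)))) := by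
      rw [div_div_eq_mul_div]; ring
    rw [h8, h9]
    linarith
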